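/- **Setting.** Let $\{\mathbb A_i\}_{i\ge 0}$ and $\{\mathbb B_i\}_{i\in\mathbb Z}$ be non-empty Polish (standard Borel) alphabets. Write $a^{i-1}=(a_0,\dots,a_{i-1})$, $b^{i-1}=(\dots,b_{-1},b_0,\dots,b_{i-1})$ and $b_{i-L}^{i-1}=(b_{i-L},\dots,b_{i-1})$ (empty if $L=0$). Fix $n\ge 0$, $M\ge 0$, a channel with finite output memory $M$, i.e. stochastic kernels $Q_i(db_i\mid b_{i-M}^{i-1},a_i)$, and a probability distribution $\mu(db^{-1})$ of the initial data $B^{-1}$. Let $\mathcal P_{[0,n]}$ be the set of all sequences $P=\{P_i(da_i\mid a^{i-1},b^{i-1})\}_{i=0}^n$ of stochastic kernels. Each $P$ induces the joint distribution $$\mathbf P^P(db^{-1},da_0,db_0,\dots,da_n,db_n)=\mu(db^{-1})\bigotimes_{i=0}^n\Big(P_i(da_i\mid a^{i-1},b^{i-1})\otimes Q_i(db_i\mid b_{i-M}^{i-1},a_i)\Big),$$ the output transition probabilities $$\Pi_i^P(db_i\mid b^{i-1})=\int Q_i(db_i\mid b_{i-M}^{i-1},a_i)\,P_i(da_i\mid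 a^{i-1},b^{i-1})\,\mathbf P^P(da^{i-1}\mid b^{i-1}),$$ and the directed information $$I^P(A^n\to B^n)=\sum_{i=0}^n\mathbf E^P\Big\{\log\frac{dQ_i(\cdot\mid B_{i-M}^{i-1},A_i)}{d\Pi_i^P(\cdot\mid B^{i-1})}(B_i)\Big\}\in[0,\infty]$$ (a term is $+\infty$ if absolute continuity fails). For a sequence $\pi=\{\pi_i(da_i\mid b_{i-J}^{i-1})\}_{i=0}^n$ of kernels, with $J\ge M$, put $v_i^\pi(db_i\mid b_{i-J}^{i-1})=\int_{\mathbb A_i}Q_i(db_i\mid b_{i-M}^{i-1},a_i)\,\pi_i(da_i\mid b_{i-J}^{i-1})$, and regard $\pi$ as an element of $\mathcal P_{[0,n]}$. Let $$\mathcal P^{B.J}_{[0,n]}=\{P:\ P_i(da_i\mid a^{i-1},b^{i-1})=\pi_i(da_i\mid b_{i-J}^{i-1})\text{ a.a. }(a^{i-1},b^{i-1}),\ i\le n,\text{ for some }\pi\},$$ $$\overline{\mathcal P}^{A}_{[0,n]}=\{P:\ P_i(da_i\mid a^{i-1},b^{i-1})=\pi_i(da_i\mid b^{i-1})\text{ a.a.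 }(a^{i-1},b^{i-1}),\ i\le n,\text{ for some kernels }\pi_i\}.$$ For measurable costs $\gamma_i(a_i,b^{i-1})\in[0,\infty)$ and $\kappa\in[0,\infty)$ let $$\mathcal P_{[0,n]}(\kappa)=\Big\{P:\ \tfrac1{n+1}\mathbf E^P\Big\{\sum_{i=0}^n\gamma_i(A_i,B^{i-1})\Big\}\le\kappa\Big\}.$$ We say that the maximization of $I(A^n\to B^n)$ over a set $S$ *occurs in* $T\subseteq S$ if the suprema over $S$ and over $T$ coincide and, whenever a maximizer over $S$ exists, there is one that lies in $T$. A supremum over the empty set is $0$. **Theorem.** For every $P\in\mathcal P_{[0,n]}$, $I^P(A^n\to B^n)=\sum_{i=0}^n I(A^i;B_i\mid B^{i-1})$. Moreover, if $J\ge M$ and $P_i(da_i\mid a^{i-1},b^{i-1})=\pi_i(da_i\mid b_{i-J}^{i-1})$ a.a. for all $i\le n$, then the output process is $J$-th order Markov: for $i=0,\dots,n$, $$\Pi_i^P(db_i\mid b^{i-1})=v_i^\pi(db_i\mid b_{i-J}^{i-1})\quad\text{a.a. } b^{i-1},$$ $$\mathbf P^P(db_{i-J}^{i},da_i)=Q_i(db_i\mid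 b_{i-M}^{i-1},a_i)\otimes\pi_i(da_i\mid b_{i-J}^{i-1})\otimes\mathbf P^P(db_{i-J}^{i-1}).$$ *Part A.* The maximization of $I(A^n\to B^n)$ over $\mathcal P_{[0,n]}$ occurs in $\mathcal P^{B.M}_{[0,n]}$, and $$\sup_{P\in\mathcal P_{[0,n]}}I^P(A^n\to B^n)=\sup_{\{\pi_i(da_i\mid b_{i-M}^{i-1})\}}\sum_{i=0}^n\mathbf E^{\pi}\Big\{\log\frac{dQ_i(\cdot\mid B_{i-M}^{i-1},A_i)}{dv_i^{\pi}(\cdot\mid B_{i-M}^{i-1})}(B_i)\Big\}=\sup_{\{\pi_i(da_i\mid b_{i-M}^{i-1})\}}\sum_{i=0}^n I(A_i;B_i\mid B_{i-M}^{i-1}).$$ *Part B.* Suppose the costs have the form $\gamma_i(a_i,b_{i-K}^{i-1})$, with $K\ge 0$ an integer, and let $J=\max\{M,K\}$. Then the maximization of $I(A^n\to B^n)$ over $\mathcal P_{[0,n]}(\kappa)$ occurs in $\mathcal P^{B.J}_{[0,n]}\cap\mathcal P_{[0,n]}(\kappa)$, and $$\sup_{P\in\mathcal P_{[0,n]}(\kappa)}I^P(A^n\to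 B^n)=\sup_{\pi}\sum_{i=0}^n\mathbf E^{\pi}\Big\{\log\frac{dQ_i(\cdot\mid B_{i-M}^{i-1},A_i)}{dv_i^{\pi}(\cdot\mid B_{i-J}^{i-1})}(B_i)\Big\}=\sup_{\pi}\sum_{i=0}^n I(A_i;B_i\mid B_{i-J}^{i-1}),$$ where $\pi$ ranges over the sequences $\{\pi_i(da_i\mid b_{i-J}^{i-1})\}_{i=0}^n$ that satisfy the cost constraint. *Part C.* For costs $\gamma_i(a_i,b^{i-1})$, the maximization of $I(A^n\to B^n)$ over $\mathcal P_{[0,n]}(\kappa)$ occurs in $\overline{\mathcal P}^{A}_{[0,n]}\cap\mathcal P_{[0,n]}(\kappa)$. No Lagrange-duality hypothesis is imposed in Parts B and C. -/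

import Mathlib

open MeasureTheory ProbabilityTheory InformationTheory
open scoped ENNReal NNReal

noncomputable section

namespace FTFI

/-! ### Histories -/

/-- Appends the symbol `x` at time `i` to a history `h` of the symbols at all times before `i`;
the result is the history of the symbols at all times before the next time `k`. -/
def snoc {ι : Type*} [LinearOrder ι] {X : ι → Type*} {i k : ι} (hik : ∀ j < k, j ≤ i)
    (h : ∀ j : Set.Iio i, X j) (x : X i) : ∀ j : Set.Iio k, X j :=
  fun j => if hj : (j : ι) < i then h ⟨j, hj⟩
    else (le_antisymm (not_lt.1 hj) (hik j j.2) : i = (j : ι)) ▸ x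

theorem measurable_cast_symbol {ι : Type*} {X : ι → Type*} [∀ i, MeasurableSpace (X i)]
    {i j : ι} (h : i = j) : Measurable (fun x : X i => (h ▸ x : X j)) := by
  subst h
  exact measurable_id

theorem measurable_snoc {ι : Type*} [LinearOrder ι] {X : ι → Type*}
    [∀ i, MeasurableSpace (X i)] {i k : ι} (hik : ∀ j < k, j ≤ i) :
    Measurable (fun p : (∀ j : Set.Iio i, X j) × X i => snoc hik p.1 p.2) := by
  refine measurable_pi_lambda _ fun j => ?_
  by_cases hj : (j : ι) < i
  · simp only [snoc, hj, dite_true]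
    exact (measurable_pi_apply (⟨j, hj⟩ : Set.Iio i)).comp measurable_fst
  · simp only [snoc, hj, dite_false]
    exact (measurable_cast_symbol _).comp measurable_snd

/-- `a^{i-1} = (a_0, …, a_{i-1})`. -/
abbrev InPast (A : ℕ → Type*) (i : ℕ) := ∀ j : Set.Iio i, A j

/-- `b^{i-1} = (…, b_{-1}, b_0, …, b_{i-1})`; in particular `OutPast B 0` is the space of the
initial data `b^{-1}`. -/
abbrev OutPast (B : ℤ → Type*) (i : ℕ) := ∀ j : Set.Iio (i : ℤ), B j

/-- The joint history `(b^{i-1}, a^{i-1})`. -/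
abbrev Hist (A : ℕ → Type*) (B : ℤ → Type*) (i : ℕ) := OutPast B i × InPast A i

/-- `b_{i-L}^{i-1} = (b_{i-L}, …, b_{i-1})`; a one-point space if `L = 0`. -/
abbrev Window (B : ℤ → Type*) (L : ℕ) (i : ℕ) := ∀ j : Set.Ico ((i : ℤ) - L) (i : ℤ), B j

/-- `b^{i-1} ↦ b_{i-L}^{i-1}`. -/
def window {B : ℤ → Type*} (L i : ℕ) (b : OutPast B i) : Window B L i :=
  fun j => b ⟨j, j.2.2⟩

/-- `b_{i-J}^{i-1} ↦ b_{i-L}^{i-1}` for `L ≤ J`. -/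
def shorten {B : ℤ → Type*} {L J : ℕ} (h : L ≤ J) (i : ℕ) (w : Window B J i) : Window B L i :=
  fun j => w ⟨j, by have := j.2.1; have := j.2.2; constructor <;> omega⟩

theorem measurable_window {B : ℤ → Type*} [∀ i, MeasurableSpace (B i)] (L i : ℕ) :
    Measurable (window (B := B) L i) :=
  measurable_pi_lambda _ fun _ => measurable_pi_apply _

theorem measurable_shorten {B : ℤ → Type*} [∀ i, MeasurableSpace (B i)] {L J : ℕ} (h : L ≤ J)
    (i : ℕ) : Measurable (shorten (B := B) h i) :=
  measurable_pi_lambda _ fun _ => measurable_pi_apply _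

/-! ### Channels and channel input distributions -/

/-- A sequence of stochastic kernels on `T i` given `S i`, for `i = 0, 1, 2, …`. -/
structure KernelSeq (S T : ℕ → Type*) [∀ i, MeasurableSpace (S i)]
    [∀ i, MeasurableSpace (T i)] where
  kernel : ∀ i, Kernel (S i) (T i)
  markov : ∀ i, IsMarkovKernel (kernel i)

attribute [instance] KernelSeq.markov

variable {A : ℕ → Type*} {B : ℤ → Type*} [∀ i, MeasurableSpace (A i)]
  [∀ i, MeasurableSpace (B i)]

/-- Channels with output memory `M`: kernels `Q_i(db_i | b_{i-M}^{i-1}, a_i)`. -/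
abbrev Channel (A : ℕ → Type*) (B : ℤ → Type*) [∀ i, MeasurableSpace (A i)]
    [∀ i, MeasurableSpace (B i)] (M : ℕ) :=
  KernelSeq (fun i => Window B M i × A i) (fun i => B i)

/-- Channel input distributions with feedback: kernels `P_i(da_i | a^{i-1}, b^{i-1})`. -/
abbrev Input (A : ℕ → Type*) (B : ℤ → Type*) [∀ i, MeasurableSpace (A i)]
    [∀ i, MeasurableSpace (B i)] :=
  KernelSeq (Hist A B) A

/-- Kernels `π_i(da_i | b_{i-J}^{i-1})`. -/
abbrev WindowInput (A : ℕ → Type*) (B : ℤ → Type*) [∀ i, MeasurableSpace (A i)]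
    [∀ i, MeasurableSpace (B i)] (J : ℕ) :=
  KernelSeq (Window B J) A

/-- Kernels `π_i(da_i | b^{i-1})`. -/
abbrev OutputInput (A : ℕ → Type*) (B : ℤ → Type*) [∀ i, MeasurableSpace (A i)]
    [∀ i, MeasurableSpace (B i)] :=
  KernelSeq (OutPast B) A

/-- `π_i(da_i | b_{i-J}^{i-1})` regarded as an input distribution
`P_i(da_i | a^{i-1}, b^{i-1})`. -/
def WindowInput.toInput {J : ℕ} (p : WindowInput A B J) : Input A B where
  kernel i := (p.kernel i).comap (fun h : Hist A B i => window J i h.1)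
    ((measurable_window J i).comp measurable_fst)
  markov _ := inferInstance

/-- The channel kernel at time `i` as a kernel given `((b^{i-1}, a^{i-1}), a_i)`. -/
def Channel.onHist {M : ℕ} (Q : Channel A B M) (i : ℕ) : Kernel (Hist A B i × A i) (B i) :=
  (Q.kernel i).comap (fun x : Hist A B i × A i => (window M i x.1.1, x.2))
    (((measurable_window M i).comp (measurable_fst.comp measurable_fst)).prodMk measurable_snd)

/-- The channel kernel at time `i` as a kernel given `(b_{i-J}^{i-1}, a_i)`, for `M ≤ J`. -/
def Channel.onWindow {M : ℕ} (Q : Channel A B M) {J : ℕ} (h : M ≤ J) (i : ℕ) :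
    Kernel (Window B J i × A i) (B i) :=
  (Q.kernel i).comap (fun x : Window B J i × A i => (shorten h i x.1, x.2))
    (((measurable_shorten h i).comp measurable_fst).prodMk measurable_snd)

instance {M : ℕ} (Q : Channel A B M) (i : ℕ) : IsMarkovKernel (Q.onHist i) := by
  unfold Channel.onHist; infer_instance

instance {M : ℕ} (Q : Channel A B M) {J : ℕ} (h : M ≤ J) (i : ℕ) :
    IsMarkovKernel (Q.onWindow h i) := by
  unfold Channel.onWindow; infer_instance

/-! ### Joint distributions -/

/-- The joint distribution of `(B^{i-1}, A^{i-1})` induced by the distribution `μ` of the initial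
data `B^{-1}`, the channel and the input distribution:
`μ(db^{-1}) ⊗ P_0 ⊗ Q_0 ⊗ ⋯ ⊗ P_{i-1} ⊗ Q_{i-1}`. -/
def law {M : ℕ} (μ : Measure (OutPast B 0)) (Q : Channel A B M) (P : Input A B) :
    ∀ i, Measure (Hist A B i)
  | 0 => μ.map fun b => (b, fun j => absurd j.2 (Nat.not_lt_zero _))
  | i + 1 => ((law μ Q P i ⊗ₘ P.kernel i) ⊗ₘ Q.onHist i).map fun x =>
      (snoc (X := B) (fun j hj => by push_cast at hj; omega) x.1.1.1 x.2,
        snoc (X := A) (fun j hj => by omega) x.1.1.2 x.1.2)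

instance isProbabilityMeasure_law {M : ℕ} (μ : Measure (OutPast B 0)) [IsProbabilityMeasure μ]
    (Q : Channel A B M) (P : Input A B) (i : ℕ) : IsProbabilityMeasure (law μ Q P i) := by
  induction i with
  | zero =>
    exact Measure.isProbabilityMeasure_map
      (measurable_id.prodMk measurable_const).aemeasurable
  | succ i ih =>
    refine Measure.isProbabilityMeasure_map (Measurable.aemeasurable (Measurable.prodMk ?_ ?_))
    · exact (measurable_snoc (X := B) (i := (i : ℤ)) (k := ((i + 1 : ℕ) : ℤ))
        (fun j hj => by push_cast at hj; omega)).comp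
        ((measurable_fst.comp (measurable_fst.comp measurable_fst)).prodMk measurable_snd)
    · exact (measurable_snoc (X := A) (i := i) (k := i + 1) (fun j hj => by omega)).comp
        ((measurable_snd.comp (measurable_fst.comp measurable_fst)).prodMk
          (measurable_snd.comp measurable_fst))

/-- The joint distribution of `((B^{i-1}, A^{i-1}), A_i)`. -/
def inputLaw {M : ℕ} (μ : Measure (OutPast B 0)) (Q : Channel A B M) (P : Input A B) (i : ℕ) :
    Measure (Hist A B i × A i) :=
  law μ Q P i ⊗ₘ P.kernel i

/-- The joint distribution of `(((B^{i-1}, A^{i-1}), A_i), B_i)`. -/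
def fullLaw {M : ℕ} (μ : Measure (OutPast B 0)) (Q : Channel A B M) (P : Input A B) (i : ℕ) :
    Measure ((Hist A B i × A i) × B i) :=
  inputLaw μ Q P i ⊗ₘ Q.onHist i

/-- The joint distribution of `(B^{i-1}, (A^i, B_i))`, with `A^i` written `(A^{i-1}, A_i)`. -/
def pastLaw {M : ℕ} (μ : Measure (OutPast B 0)) (Q : Channel A B M) (P : Input A B) (i : ℕ) :
    Measure (OutPast B i × ((InPast A i × A i) × B i)) :=
  (fullLaw μ Q P i).map fun x => (x.1.1.1, ((x.1.1.2, x.1.2), x.2))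

/-- The joint distribution of `(B_{i-J}^{i-1}, (A_i, B_i))`. -/
def windowLaw {M : ℕ} (μ : Measure (OutPast B 0)) (Q : Channel A B M) (P : Input A B)
    (J i : ℕ) : Measure (Window B J i × (A i × B i)) :=
  (fullLaw μ Q P i).map fun x => (window J i x.1.1.1, (x.1.2, x.2))

/-- The channel output transition probability
`Π_i^P(db_i | b^{i-1}) = ∫ Q_i(db_i | b_{i-M}^{i-1}, a_i) P_i(da_i | a^{i-1}, b^{i-1})
  𝐏^P(da^{i-1} | b^{i-1})`, where `𝐏^P(da^{i-1} | b^{i-1})` is the regular conditional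
distribution obtained by disintegrating the joint distribution of `(B^{i-1}, A^{i-1})`. -/
def outKernel [∀ i, StandardBorelSpace (A i)] [∀ i, Nonempty (A i)] {M : ℕ}
    (μ : Measure (OutPast B 0)) [IsProbabilityMeasure μ] (Q : Channel A B M) (P : Input A B)
    (i : ℕ) : Kernel (OutPast B i) (B i) :=
  (((law μ Q P i).condKernel ⊗ₖ P.kernel i) ⊗ₖ
    ((Q.onHist i).comap
      (fun x : OutPast B i × (InPast A i × A i) => ((x.1, x.2.1), x.2.2))
      (by fun_prop))).snd

/-- `v_i^π(db_i | b_{i-J}^{i-1}) = ∫ Q_i(db_i | b_{i-M}^{i-1}, a_i) π_i(da_i | b_{i-J}^{i-1})`. -/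
def windowOutKernel {M : ℕ} (Q : Channel A B M) {J : ℕ} (h : M ≤ J) (p : WindowInput A B J)
    (i : ℕ) : Kernel (Window B J i) (B i) :=
  (p.kernel i ⊗ₖ Q.onWindow h i).snd

/-! ### Information measures -/

/-- For `X ~ ρ` and `Y | X ~ κ(·|X)`, the expected log-likelihood ratio
`𝔼 log (dκ(·|X)/dη(·|X))(Y) ∈ [0, ∞]`, i.e. the relative entropy of the joint distribution
`ρ(dx) κ(dy|x)` with respect to `ρ(dx) η(dy|x)`; it is `∞` if absolute continuity fails. -/
def expLogRatio {X Y : Type*} [MeasurableSpace X] [MeasurableSpace Y] (ρ : Measure X)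
    (κ η : Kernel X Y) : ℝ≥0∞ :=
  klDiv (ρ ⊗ₘ κ) (ρ ⊗ₘ η)

/-- The conditional mutual information `I(U; Z | W)` of a triple with joint distribution `ρ`: the
relative entropy of `ρ(dw, du, dz)` with respect to `ρ(dw) ρ(du|w) ρ(dz|w)`. -/
def condMutualInfo {W U Z : Type*} [MeasurableSpace W] [MeasurableSpace U] [MeasurableSpace Z]
    [StandardBorelSpace U] [StandardBorelSpace Z] [Nonempty U] [Nonempty Z]
    (ρ : Measure (W × (U × Z))) [IsFiniteMeasure ρ] : ℝ≥0∞ :=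
  klDiv ρ (ρ.fst ⊗ₘ (ρ.condKernel.fst ×ₖ ρ.condKernel.snd))

instance {M : ℕ} (μ : Measure (OutPast B 0)) [IsProbabilityMeasure μ]
    (Q : Channel A B M) (P : Input A B) (i : ℕ) : IsProbabilityMeasure (inputLaw μ Q P i) := by
  unfold inputLaw; infer_instance

instance {M : ℕ} (μ : Measure (OutPast B 0)) [IsProbabilityMeasure μ]
    (Q : Channel A B M) (P : Input A B) (i : ℕ) : IsProbabilityMeasure (fullLaw μ Q P i) := by
  unfold fullLaw; infer_instance

instance {M : ℕ} (μ : Measure (OutPast B 0)) [IsProbabilityMeasure μ]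
    (Q : Channel A B M) (P : Input A B) (i : ℕ) : IsProbabilityMeasure (pastLaw μ Q P i) :=
  Measure.isProbabilityMeasure_map (by fun_prop)

instance {M : ℕ} (μ : Measure (OutPast B 0)) [IsProbabilityMeasure μ]
    (Q : Channel A B M) (P : Input A B) (J i : ℕ) :
    IsProbabilityMeasure (windowLaw μ Q P J i) :=
  Measure.isProbabilityMeasure_map
    (((measurable_window J i).comp (by fun_prop)).prodMk (by fun_prop)).aemeasurable

/-- Directed information
`I(A^n → B^n) = ∑_{i ≤ n} 𝔼^P log (dQ_i(·|B_{i-M}^{i-1}, A_i) / dΠ_i^P(·|B^{i-1}))(B_i)`. -/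
def directedInfo [∀ i, StandardBorelSpace (A i)] [∀ i, Nonempty (A i)] {M : ℕ}
    (μ : Measure (OutPast B 0)) [IsProbabilityMeasure μ] (Q : Channel A B M) (n : ℕ)
    (P : Input A B) : ℝ≥0∞ :=
  ∑ i ∈ Finset.range (n + 1), expLogRatio (inputLaw μ Q P i) (Q.onHist i)
    ((outKernel μ Q P i).comap (fun x : Hist A B i × A i => x.1.1) (by fun_prop))

/-- `∑_{i ≤ n} 𝔼^π log (dQ_i(·|B_{i-M}^{i-1}, A_i) / dv_i^π(·|B_{i-J}^{i-1}))(B_i)`. -/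
def windowPayoff {M : ℕ} (μ : Measure (OutPast B 0)) (Q : Channel A B M)
    {J : ℕ} (h : M ≤ J) (n : ℕ) (p : WindowInput A B J) : ℝ≥0∞ :=
  ∑ i ∈ Finset.range (n + 1),
    expLogRatio
      ((inputLaw μ Q p.toInput i).map fun x : Hist A B i × A i => (window J i x.1.1, x.2))
      (Q.onWindow h i)
      ((windowOutKernel Q h p i).comap (fun x : Window B J i × A i => x.1) measurable_fst)

/-- `∑_{i ≤ n} I(A_i; B_i | B_{i-J}^{i-1})` under the input distribution `π`. -/
def windowInfo [∀ i, StandardBorelSpace (A i)] [∀ i, Nonempty (A i)]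
    [∀ i, StandardBorelSpace (B i)] [∀ i, Nonempty (B i)] {M : ℕ}
    (μ : Measure (OutPast B 0)) [IsProbabilityMeasure μ] (Q : Channel A B M) {J : ℕ} (n : ℕ)
    (p : WindowInput A B J) : ℝ≥0∞ :=
  ∑ i ∈ Finset.range (n + 1), condMutualInfo (windowLaw μ Q p.toInput J i)

/-! ### Classes of input distributions -/

/-- `P_i(da_i | a^{i-1}, b^{i-1}) = π_i(da_i | b_{i-J}^{i-1})` for almost all
`(a^{i-1}, b^{i-1})`, for `i = 0, …, n`. -/
def EqWindow {M : ℕ} (μ : Measure (OutPast B 0)) (Q : Channel A B M) (n : ℕ) {J : ℕ}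
    (P : Input A B) (p : WindowInput A B J) : Prop :=
  ∀ i ≤ n, ∀ᵐ h ∂(law μ Q P i), P.kernel i h = p.kernel i (window J i h.1)

/-- The input distributions that depend on `b_{i-J}^{i-1}` only. -/
def windowClass {M : ℕ} (μ : Measure (OutPast B 0)) (Q : Channel A B M) (n J : ℕ) :
    Set (Input A B) :=
  {P | ∃ p : WindowInput A B J, EqWindow μ Q n P p}

/-- The input distributions that depend on `b^{i-1}` only:
`P_i(da_i | a^{i-1}, b^{i-1}) = π_i(da_i | b^{i-1})` for almost all `(a^{i-1}, b^{i-1})`. -/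
def outputClass {M : ℕ} (μ : Measure (OutPast B 0)) (Q : Channel A B M) (n : ℕ) :
    Set (Input A B) :=
  {P | ∃ p : OutputInput A B, ∀ i ≤ n, ∀ᵐ h ∂(law μ Q P i), P.kernel i h = p.kernel i h.1}

/-- The average transmission cost `(1/(n+1)) 𝔼^P ∑_{i ≤ n} γ_i(A_i, B^{i-1})`. -/
def avgCost {M : ℕ} (μ : Measure (OutPast B 0)) (Q : Channel A B M) (n : ℕ)
    (γ : ∀ i, A i × OutPast B i → ℝ≥0) (P : Input A B) : ℝ≥0∞ :=
  (∑ i ∈ Finset.range (n + 1), ∫⁻ x, γ i (x.2, x.1.1) ∂(inputLaw μ Q P i)) / (n + 1)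

/-- The input distributions whose average transmission cost is at most `κ`. -/
def costClass {M : ℕ} (μ : Measure (OutPast B 0)) (Q : Channel A B M) (n : ℕ)
    (γ : ∀ i, A i × OutPast B i → ℝ≥0) (κ : ℝ≥0) : Set (Input A B) :=
  {P | avgCost μ Q n γ P ≤ κ}

/-- A cost of the form `γ_i(a_i, b_{i-K}^{i-1})` as a function of `(a_i, b^{i-1})`. -/
def windowCost {K : ℕ} (γ : ∀ i, A i × Window B K i → ℝ≥0) : ∀ i, A i × OutPast B i → ℝ≥0 :=
  fun i x => γ i (x.1, window K i x.2)

/-- The maximization of `F` over `S` occurs in the subset `T` of `S`: the suprema of `F` over `S`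
and over `T` agree, and if a maximizer over `S` exists, then `T` contains one. -/
def MaximizationOccursIn {α : Type*} (F : α → ℝ≥0∞) (S T : Set α) : Prop :=
  T ⊆ S ∧ (⨆ P ∈ S, F P) = (⨆ P ∈ T, F P) ∧
    ((∃ P ∈ S, IsMaxOn F S P) → ∃ P ∈ T, IsMaxOn F S P)

end FTFI

end

/-! The optimal input needs only a statistic `s_i(b^{i-1})` of the past outputs that determines the
channel kernel and can be updated from `s_i` and `b_i`: a window of length `J ≥ M`, or the whole
output past. Given any `P`, let `p_i` be the conditional law of `A_i` given `s_i` under `P`, and use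
`p` as a new input. By induction the law of `s_i`, hence that of `(s_i, A_i)`, is unchanged
(`map_stat_law_eq`), so every cost that is a function of `(s_i, A_i)` is unchanged too
(`avgCost_congr`). This is why no duality argument is needed.

The information can only grow. The kernel `Π_i^P` is the true conditional law of `B_i` given
`B^{i-1}`, and by the chain rule for relative entropy it minimizes the expected log-likelihood ratio
among all reference kernels given `B^{i-1}` (`expLogRatio_le_of_isCond`). Replacing it by the kernel
`v_i` given `s_i` that `p_i` and the channel induce gives an upper bound for the `i`-th term. That
bound depends only on the law of `(s_i, A_i)` (`expLogRatio_comap`), and under the new input `v_i`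
is the true output kernel, so the bound is the new `i`-th term. `exists_statInput_ge` combines these
facts. -/

namespace FTFI

/-! ### Relative entropy, sufficient statistics and conditional mutual information -/

section General

variable {X Y W U V : Type*} [MeasurableSpace X] [MeasurableSpace Y] [MeasurableSpace W]
  [MeasurableSpace U] [MeasurableSpace V]

theorem map_prodMap_compProd_comap (ρ : Measure X) [IsProbabilityMeasure ρ] (κ : Kernel V Y)
    [IsMarkovKernel κ] {f : X → V} (hf : Measurable f) :
    (ρ ⊗ₘ κ.comap f hf).map (fun z : X × Y => (f z.1, z.2)) = ρ.map f ⊗ₘ κ := by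
  have : IsProbabilityMeasure (ρ.map f) := Measure.isProbabilityMeasure_map hf.aemeasurable
  refine Measure.ext_of_lintegral _ fun g hg => ?_
  rw [lintegral_map hg (by fun_prop), Measure.lintegral_compProd (by fun_prop),
    Measure.lintegral_compProd hg, lintegral_map (by fun_prop) hf]
  rfl

/-- A joint law whose output kernel depends on the input only through `f`, with the input
generated last from its conditional distribution `K` given `f`. -/
theorem map_graph_compProd_comap (ρ : Measure X) [IsProbabilityMeasure ρ] (κ : Kernel V Y)
    [IsMarkovKernel κ] {f : X → V} (hf : Measurable f) (K : Kernel V X) [IsMarkovKernel K]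
    (hK : ρ.map f ⊗ₘ K = ρ.map (fun x => (f x, x))) :
    (ρ ⊗ₘ κ.comap f hf).map (fun z : X × Y => ((f z.1, z.2), z.1)) =
      (ρ.map f ⊗ₘ κ) ⊗ₘ K.comap (Prod.fst : V × Y → V) measurable_fst := by
  have : IsProbabilityMeasure (ρ.map f) := Measure.isProbabilityMeasure_map hf.aemeasurable
  refine Measure.ext_of_lintegral _ fun g hg => ?_
  rw [lintegral_map hg (by fun_prop), Measure.lintegral_compProd (by fun_prop),
    Measure.lintegral_compProd hg, Measure.lintegral_compProd (by fun_prop)]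
  -- Given `v = f x`, input and output are conditionally independent, so they may be generated in
  -- either order.
  have h1 : ∀ v, ∫⁻ y, ∫⁻ x, g ((v, y), x) ∂K v ∂κ v = ∫⁻ x, ∫⁻ y, g ((v, y), x) ∂κ v ∂K v :=
    fun v => lintegral_lintegral_swap
      (Measurable.aemeasurable (by simpa [Function.uncurry_def] using by fun_prop))
  simp only [Kernel.comap_apply, h1]
  have h2 : Measurable fun p : V × X => ∫⁻ y, g ((p.1, y), p.2) ∂κ p.1 :=
    Measurable.lintegral_kernel_prod_right
      (κ := κ.comap (Prod.fst : V × X → V) measurable_fst)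
      (f := fun (p : V × X) y => g ((p.1, y), p.2))
      (by simpa [Function.uncurry_def] using by fun_prop)
  rw [← Measure.lintegral_compProd (f := fun p : V × X => ∫⁻ y, g ((p.1, y), p.2) ∂κ p.1) h2, hK,
    lintegral_map h2 (by fun_prop)]

/-- The regular conditional law of `x` given `f x`. It restores `x` after a passage to the
statistic, by a kernel that does not involve the output kernel. -/
theorem exists_condKernel_graph [StandardBorelSpace X] [Nonempty X] (ρ : Measure X)
    [IsProbabilityMeasure ρ] {f : X → V} (hf : Measurable f) :
    ∃ K : Kernel V X, IsMarkovKernel K ∧ ρ.map f ⊗ₘ K = ρ.map (fun x => (f x, x)) := by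
  have : IsProbabilityMeasure (ρ.map fun x => (f x, x)) :=
    Measure.isProbabilityMeasure_map (by fun_prop)
  refine ⟨(ρ.map fun x => (f x, x)).condKernel, inferInstance, ?_⟩
  have h := (ρ.map fun x => (f x, x)).disintegrate (ρ.map fun x => (f x, x)).condKernel
  rwa [Measure.fst_map_prodMk (by fun_prop)] at h

/-- The expected log-likelihood ratio depends only on the statistic on which both kernels
depend. -/
theorem expLogRatio_comap [StandardBorelSpace X] [Nonempty X] (ρ : Measure X)
    [IsProbabilityMeasure ρ] (κ η : Kernel V Y) [IsMarkovKernel κ] [IsMarkovKernel η]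
    {f : X → V} (hf : Measurable f) :
    expLogRatio ρ (κ.comap f hf) (η.comap f hf) = expLogRatio (ρ.map f) κ η := by
  have : IsProbabilityMeasure (ρ.map f) := Measure.isProbabilityMeasure_map hf.aemeasurable
  obtain ⟨K, _, hK⟩ := exists_condKernel_graph ρ hf
  apply le_antisymm
  -- Both joint laws are recovered from their images by appending the same kernel `K`, which leaves
  -- the relative entropy unchanged. The reverse inequality is data processing under `f`.
  · have key : ∀ (κ : Kernel V Y) [IsMarkovKernel κ], ρ ⊗ₘ κ.comap f hf =
        ((ρ.map f ⊗ₘ κ) ⊗ₘ K.comap (Prod.fst : V × Y → V) measurable_fst).map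
          (fun z => (z.2, z.1.2)) := by
      intro κ _
      rw [← map_graph_compProd_comap ρ κ hf K hK, Measure.map_map (by fun_prop) (by fun_prop)]
      exact Measure.map_id.symm
    unfold expLogRatio
    rw [key κ, key η]
    exact (klDiv_map_le _ _ (by fun_prop)).trans_eq (klDiv_compProd_left _ _ _)
  · unfold expLogRatio
    rw [← map_prodMap_compProd_comap ρ κ hf, ← map_prodMap_compProd_comap ρ η hf]
    exact klDiv_map_le _ _ (by fun_prop)

/-- Among the kernels that depend on the statistic `w` only, the conditional output distribution
given `w` minimizes the expected log-likelihood ratio. -/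
theorem expLogRatio_le_of_isCond [StandardBorelSpace X] [Nonempty X] (ρ : Measure X)
    [IsProbabilityMeasure ρ] (κ : Kernel X Y) [IsMarkovKernel κ] {w : X → W} (hw : Measurable w)
    (η v : Kernel W Y) [IsMarkovKernel η] [IsMarkovKernel v]
    (hη : (ρ ⊗ₘ κ).map (fun z : X × Y => (w z.1, z.2)) = ρ.map w ⊗ₘ η) :
    expLogRatio ρ κ (η.comap w hw) ≤ expLogRatio ρ κ (v.comap w hw) := by
  have : IsProbabilityMeasure (ρ.map w) := Measure.isProbabilityMeasure_map hw.aemeasurable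
  obtain ⟨K, _, hK⟩ := exists_condKernel_graph ρ hw
  have : IsProbabilityMeasure ((ρ ⊗ₘ κ).map fun z : X × Y => ((w z.1, z.2), z.1)) :=
    Measure.isProbabilityMeasure_map (by fun_prop)
  set τ := (ρ ⊗ₘ κ).map fun z : X × Y => ((w z.1, z.2), z.1) with hτ
  have hτ1 : τ.fst = ρ.map w ⊗ₘ η := by
    rw [← hη, hτ, Measure.fst_map_prodMk (by fun_prop)]
  have hτ2 : (ρ.map w ⊗ₘ η) ⊗ₘ τ.condKernel = τ := by
    rw [← hτ1]; exact τ.disintegrate _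
  have hback : ρ ⊗ₘ κ = τ.map (fun z => (z.2, z.1.2)) := by
    rw [hτ, Measure.map_map (by fun_prop) (by fun_prop)]
    exact Measure.map_id.symm
  have hback' : ρ ⊗ₘ η.comap w hw =
      ((ρ.map w ⊗ₘ η) ⊗ₘ K.comap (Prod.fst : W × Y → W) measurable_fst).map
        (fun z => (z.2, z.1.2)) := by
    rw [← map_graph_compProd_comap ρ η hw K hK, Measure.map_map (by fun_prop) (by fun_prop)]
    exact Measure.map_id.symm
  unfold expLogRatio
  calc klDiv (ρ ⊗ₘ κ) (ρ ⊗ₘ η.comap w hw)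
      ≤ klDiv τ ((ρ.map w ⊗ₘ η) ⊗ₘ K.comap (Prod.fst : W × Y → W) measurable_fst) := by
        rw [hback, hback']
        exact klDiv_map_le _ _ (by fun_prop)
    -- Chain rule over the pair `(w, y)`, whose true law is `ρ.map w ⊗ₘ η`: the reference `v` costs
    -- the extra nonnegative term `klDiv (ρ.map w ⊗ₘ η) (ρ.map w ⊗ₘ v)`. Infinite values are
    -- covered.
    _ ≤ klDiv τ ((ρ.map w ⊗ₘ v) ⊗ₘ K.comap (Prod.fst : W × Y → W) measurable_fst) := by
        rw [← hτ2, klDiv_compProd_eq_add (ρ.map w ⊗ₘ η) (ρ.map w ⊗ₘ v)]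
        exact le_add_self
    _ ≤ klDiv (ρ ⊗ₘ κ) (ρ ⊗ₘ v.comap w hw) := by
        rw [← map_graph_compProd_comap ρ v hw K hK]
        exact klDiv_map_le _ _ (by fun_prop)

theorem klDiv_map_measurableEquiv (ρ ν : Measure X) [IsFiniteMeasure ρ] [IsFiniteMeasure ν]
    (e : X ≃ᵐ Y) : klDiv (ρ.map e) (ν.map e) = klDiv ρ ν := by
  refine le_antisymm (klDiv_map_le _ _ e.measurable) ?_
  have h := klDiv_map_le (ρ.map e) (ν.map e) e.symm.measurable
  simpa [Measure.map_map e.symm.measurable e.measurable] using h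

/-- Conditional independence given `W` means that the second symbol is generated without looking at
the first. This brings the reference measure of `condMutualInfo` to the form used in `expLogRatio`.
-/
theorem compProd_prod_eq_map (ν : Measure W) [IsProbabilityMeasure ν] (F : Kernel W U)
    (η : Kernel W Y) [IsMarkovKernel F] [IsMarkovKernel η] :
    ν ⊗ₘ (F ×ₖ η) =
      ((ν ⊗ₘ F) ⊗ₘ η.comap (Prod.fst : W × U → W) measurable_fst).map
        MeasurableEquiv.prodAssoc := by
  refine Measure.ext_of_lintegral _ fun g hg => ?_
  rw [lintegral_map hg (by fun_prop), Measure.lintegral_compProd hg,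
    Measure.lintegral_compProd (by fun_prop), Measure.lintegral_compProd]
  · refine lintegral_congr fun x => ?_
    rw [Kernel.lintegral_prod _ _ _ (by fun_prop)]
    rfl
  · exact Measurable.lintegral_kernel_prod_right
      (κ := η.comap (Prod.fst : W × U → W) measurable_fst)
      (f := fun (p : W × U) y => g (MeasurableEquiv.prodAssoc (p, y)))
      (by simpa [Function.uncurry_def] using by fun_prop)

/-- The expected log-likelihood ratio of a channel with respect to the conditional output
distribution given `W` is the conditional mutual information given `W`. -/
theorem expLogRatio_eq_condMutualInfo [StandardBorelSpace U] [Nonempty U] [StandardBorelSpace Y]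
    [Nonempty Y] (ρ : Measure (W × U)) [IsProbabilityMeasure ρ] (κ : Kernel (W × U) Y)
    [IsMarkovKernel κ] (η : Kernel W Y) [IsMarkovKernel η]
    (hη : (ρ ⊗ₘ κ).map (fun z => (z.1.1, z.2)) = ρ.fst ⊗ₘ η)
    (τ : Measure (W × (U × Y))) [IsFiniteMeasure τ]
    (hτ : τ = (ρ ⊗ₘ κ).map MeasurableEquiv.prodAssoc) :
    expLogRatio ρ κ (η.comap Prod.fst measurable_fst) = condMutualInfo τ := by
  have hfst : τ.fst = ρ.fst := by
    rw [hτ, Measure.fst, Measure.map_map (by fun_prop) (by fun_prop)]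
    conv_rhs => rw [← Measure.fst_compProd ρ κ, Measure.fst, Measure.fst,
      Measure.map_map (by fun_prop) (by fun_prop)]
    rfl
  have hF : ρ.fst ⊗ₘ τ.condKernel.fst = ρ := by
    have h := τ.disintegrate τ.condKernel
    rw [Kernel.fst_eq, Measure.compProd_map (by fun_prop), ← hfst, h, hτ,
      Measure.map_map (by fun_prop) (by fun_prop)]
    exact Measure.fst_compProd ρ κ
  have hS : ρ.fst ⊗ₘ τ.condKernel.snd = ρ.fst ⊗ₘ η := by
    have h := τ.disintegrate τ.condKernel
    rw [← hη, Kernel.snd_eq, Measure.compProd_map (by fun_prop), ← hfst, h, hτ,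
      Measure.map_map (by fun_prop) (by fun_prop)]
    rfl
  -- Conditional laws in a standard Borel space are a.e. unique, so the conditional output law
  -- chosen inside `condMutualInfo` may be replaced by `η`.
  have hS' := Kernel.ae_eq_of_compProd_eq hS
  have h1 : τ.fst ⊗ₘ (τ.condKernel.fst ×ₖ τ.condKernel.snd) =
      (ρ ⊗ₘ η.comap Prod.fst measurable_fst).map MeasurableEquiv.prodAssoc := by
    rw [hfst, Measure.compProd_congr (η := τ.condKernel.fst ×ₖ η), compProd_prod_eq_map, hF]
    filter_upwards [hS'] with x hx
    rw [Kernel.prod_apply, Kernel.prod_apply, hx]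
  unfold condMutualInfo expLogRatio
  rw [h1, ← klDiv_map_measurableEquiv _ _ MeasurableEquiv.prodAssoc, hτ]

end General

/-! ### Marginals and pullbacks of composed kernels -/

section CompProd

variable {X Y S U V : Type*} [MeasurableSpace X] [MeasurableSpace Y] [MeasurableSpace S]
  [MeasurableSpace U] [MeasurableSpace V]

theorem map_fst_snd_compProd_compProd (ν : Measure S) [SFinite ν] (p : Kernel S U)
    [IsSFiniteKernel p] (q : Kernel (S × U) Y) [IsSFiniteKernel q] :
    ((ν ⊗ₘ p) ⊗ₘ q).map (fun z => (z.1.1, z.2)) = ν ⊗ₘ (p ⊗ₖ q).snd := by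
  rw [Kernel.snd_eq, Measure.compProd_map measurable_snd, ← Measure.compProd_assoc',
    Measure.map_map (by fun_prop) (by fun_prop)]
  rfl

theorem compProd_comap_comap (p : Kernel S U) [IsSFiniteKernel p] (q : Kernel (S × U) Y)
    [IsSFiniteKernel q] {f : V → S} (hf : Measurable f) :
    p.comap f hf ⊗ₖ q.comap (fun x : V × U => (f x.1, x.2)) (by fun_prop) =
      (p ⊗ₖ q).comap f hf := by
  ext x t ht
  rw [Kernel.comap_apply, Kernel.compProd_apply ht, Kernel.compProd_apply ht]
  rfl

end CompProd

section Model

variable {A : ℕ → Type*} {B : ℤ → Type*} [∀ i, MeasurableSpace (A i)]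
  [∀ i, MeasurableSpace (B i)] {M : ℕ}

instance {J : ℕ} (Q : Channel A B M) (h : M ≤ J) (p : WindowInput A B J) (i : ℕ) :
    IsMarkovKernel (windowOutKernel Q h p i) := by
  unfold windowOutKernel; infer_instance

instance [∀ i, StandardBorelSpace (A i)] [∀ i, Nonempty (A i)] (μ : Measure (OutPast B 0))
    [IsProbabilityMeasure μ] (Q : Channel A B M) (P : Input A B) (i : ℕ) :
    IsMarkovKernel (outKernel μ Q P i) := by
  unfold outKernel; infer_instance

section Stage

/-! ### A single stage, with a statistic `s` of the past outputs -/

variable (μ : Measure (OutPast B 0)) [IsProbabilityMeasure μ] (Q : Channel A B M) (P : Input A B)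
  (i : ℕ) {S : Type*} [MeasurableSpace S] {s : OutPast B i → S}

/-- The joint law of `(s(B^{i-1}), A_i)`. -/
noncomputable def statLaw (s : OutPast B i → S) : Measure (S × A i) :=
  (inputLaw μ Q P i).map fun x => (s x.1.1, x.2)

theorem isProbabilityMeasure_statLaw (hs : Measurable s) :
    IsProbabilityMeasure (statLaw μ Q P i s) :=
  Measure.isProbabilityMeasure_map (by fun_prop)

theorem map_inputLaw_outPast :
    (inputLaw μ Q P i).map (fun x => x.1.1) = (law μ Q P i).fst := by
  rw [← Measure.fst_compProd (law μ Q P i) (P.kernel i), Measure.fst, Measure.fst,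
    Measure.map_map (by fun_prop) (by fun_prop)]
  rfl

theorem statLaw_eq_compProd (hs : Measurable s) {p : Kernel S (A i)} [IsMarkovKernel p]
    (hP : ∀ᵐ h ∂(law μ Q P i), P.kernel i h = p (s h.1)) :
    statLaw μ Q P i s = (law μ Q P i).fst.map s ⊗ₘ p := by
  have h : inputLaw μ Q P i =
      law μ Q P i ⊗ₘ p.comap (fun h : Hist A B i => s h.1) (by fun_prop) :=
    Measure.compProd_congr hP
  rw [statLaw, h, Measure.fst, Measure.map_map hs measurable_fst]
  exact map_prodMap_compProd_comap (law μ Q P i) p (f := fun h : Hist A B i => s h.1)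
    (by fun_prop)

/-- Here `P` is arbitrary: disintegration supplies the conditional law of `A_i` given the statistic,
which later serves as the replacement input. -/
theorem exists_statLaw_eq_compProd [StandardBorelSpace (A i)] [Nonempty (A i)]
    (hs : Measurable s) :
    ∃ p : Kernel S (A i), IsMarkovKernel p ∧
      statLaw μ Q P i s = (law μ Q P i).fst.map s ⊗ₘ p := by
  have := isProbabilityMeasure_statLaw μ Q P i hs
  refine ⟨(statLaw μ Q P i s).condKernel, inferInstance, ?_⟩
  have h : (statLaw μ Q P i s).fst = (law μ Q P i).fst.map s := by
    rw [statLaw, Measure.fst_map_prodMk (by fun_prop), ← map_inputLaw_outPast,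
      Measure.map_map hs (by fun_prop)]
    rfl
  rw [← h]
  exact ((statLaw μ Q P i s).disintegrate _).symm

/-- The hypothesis `hq` is the sufficiency of `s` for the channel; given `(s, A_i)`, the rest of the
history has no influence on `B_i`. -/
theorem map_fullLaw_eq_compProd (hs : Measurable s) {q : Kernel (S × A i) (B i)}
    [IsMarkovKernel q]
    (hq : Q.onHist i = q.comap (fun x : Hist A B i × A i => (s x.1.1, x.2)) (by fun_prop)) :
    (fullLaw μ Q P i).map (fun x => ((s x.1.1.1, x.1.2), x.2)) = statLaw μ Q P i s ⊗ₘ q := by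
  rw [fullLaw, hq]
  exact map_prodMap_compProd_comap _ q (f := fun x : Hist A B i × A i => (s x.1.1, x.2))
    (by fun_prop)

variable [∀ i, StandardBorelSpace (A i)] [∀ i, Nonempty (A i)]

/-- The channel kernel as a kernel given `(b^{i-1}, a^i)`. -/
noncomputable def Channel.onPast (Q : Channel A B M) (i : ℕ) :
    Kernel (OutPast B i × (InPast A i × A i)) (B i) :=
  (Q.onHist i).comap (fun x => ((x.1, x.2.1), x.2.2)) (by fun_prop)

instance (Q : Channel A B M) (i : ℕ) : IsMarkovKernel (Q.onPast i) := by
  unfold Channel.onPast; infer_instance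

/-- `Π_i^P` is the conditional distribution of `B_i` given `B^{i-1}`. -/
theorem compProd_outKernel :
    (law μ Q P i).fst ⊗ₘ outKernel μ Q P i = (fullLaw μ Q P i).map fun x => (x.1.1.1, x.2) := by
  have h : (fullLaw μ Q P i).map (fun x => (MeasurableEquiv.prodAssoc x.1, x.2)) =
      (inputLaw μ Q P i).map MeasurableEquiv.prodAssoc ⊗ₘ Q.onPast i :=
    map_prodMap_compProd_comap (inputLaw μ Q P i) (Q.onPast i)
      (MeasurableEquiv.measurable MeasurableEquiv.prodAssoc)
  have h' : (inputLaw μ Q P i).map MeasurableEquiv.prodAssoc =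
      (law μ Q P i).fst ⊗ₘ ((law μ Q P i).condKernel ⊗ₖ P.kernel i) := by
    rw [← Measure.compProd_assoc', (law μ Q P i).disintegrate]
    rfl
  rw [h'] at h
  have h2 := map_fst_snd_compProd_compProd (law μ Q P i).fst
    ((law μ Q P i).condKernel ⊗ₖ P.kernel i) (Q.onPast i)
  rw [← h, Measure.map_map (by fun_prop) (by fun_prop)] at h2
  exact h2.symm

/-- Neither the input nor the channel sees `a^{i-1}`, so averaging over it changes nothing. Both
kernels are conditional laws of `B_i` given the whole of `B^{i-1}`, hence a.e. equal; this is why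
the earlier lemmas are applied with the statistic `id`. -/
theorem outKernel_ae_eq [∀ i, StandardBorelSpace (B i)] (hs : Measurable s)
    {q : Kernel (S × A i) (B i)} [IsMarkovKernel q]
    (hq : Q.onHist i = q.comap (fun x : Hist A B i × A i => (s x.1.1, x.2)) (by fun_prop))
    {p : Kernel S (A i)} [IsMarkovKernel p]
    (hP : ∀ᵐ h ∂(law μ Q P i), P.kernel i h = p (s h.1)) :
    ∀ᵐ b ∂(law μ Q P i).fst, outKernel μ Q P i b = (p ⊗ₖ q).snd (s b) := by
  have h1 := statLaw_eq_compProd μ Q P i (s := id) measurable_id (p := p.comap s hs) hP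
  have h2 := map_fullLaw_eq_compProd μ Q P i (s := id) measurable_id
    (q := q.comap (fun x : OutPast B i × A i => (s x.1, x.2)) (by fun_prop)) hq
  have h3 := map_fst_snd_compProd_compProd (law μ Q P i).fst (p.comap s hs)
    (q.comap (fun x : OutPast B i × A i => (s x.1, x.2)) (by fun_prop))
  rw [h1, Measure.map_id] at h2
  rw [← h2, Measure.map_map (by fun_prop) (by fun_prop), compProd_comap_comap] at h3
  exact Kernel.ae_eq_of_compProd_eq (η := (p ⊗ₖ q).snd.comap s hs)
    ((compProd_outKernel μ Q P i).trans h3)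

/-- The `i`-th term of the directed information. -/
noncomputable def stageInfo : ℝ≥0∞ :=
  expLogRatio (inputLaw μ Q P i) (Q.onHist i)
    ((outKernel μ Q P i).comap (fun x : Hist A B i × A i => x.1.1) (by fun_prop))

theorem expLogRatio_comap_stat [∀ i, StandardBorelSpace (B i)] [∀ i, Nonempty (B i)]
    (hs : Measurable s) {q : Kernel (S × A i) (B i)} [IsMarkovKernel q]
    (hq : Q.onHist i = q.comap (fun x : Hist A B i × A i => (s x.1.1, x.2)) (by fun_prop))
    (v : Kernel S (B i)) [IsMarkovKernel v] :
    expLogRatio (inputLaw μ Q P i) (Q.onHist i)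
      ((v.comap s hs).comap (fun x : Hist A B i × A i => x.1.1) (by fun_prop)) =
      expLogRatio (statLaw μ Q P i s) q (v.comap Prod.fst measurable_fst) := by
  rw [hq]
  exact expLogRatio_comap (inputLaw μ Q P i) q (v.comap Prod.fst measurable_fst)
    (f := fun x : Hist A B i × A i => (s x.1.1, x.2)) (by fun_prop)

/-- The pullback of `v` along `s` is one competitor to the optimal reference `Π_i^P`. The bound sees
`P` only through the law of `(s, A_i)`. -/
theorem stageInfo_le [∀ i, StandardBorelSpace (B i)] [∀ i, Nonempty (B i)]
    (hs : Measurable s) {q : Kernel (S × A i) (B i)} [IsMarkovKernel q]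
    (hq : Q.onHist i = q.comap (fun x : Hist A B i × A i => (s x.1.1, x.2)) (by fun_prop))
    (v : Kernel S (B i)) [IsMarkovKernel v] :
    stageInfo μ Q P i ≤ expLogRatio (statLaw μ Q P i s) q (v.comap Prod.fst measurable_fst) := by
  rw [← expLogRatio_comap_stat μ Q P i hs hq v]
  refine expLogRatio_le_of_isCond _ _ _ _ _ ?_
  rw [map_inputLaw_outPast, compProd_outKernel]
  rfl

/-- When the input depends on `s` only, `Π_i^P` itself factors through `s`, so `stageInfo_le` is
attained by the induced output kernel. -/
theorem stageInfo_eq [∀ i, StandardBorelSpace (B i)] [∀ i, Nonempty (B i)]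
    (hs : Measurable s) {q : Kernel (S × A i) (B i)} [IsMarkovKernel q]
    (hq : Q.onHist i = q.comap (fun x : Hist A B i × A i => (s x.1.1, x.2)) (by fun_prop))
    {p : Kernel S (A i)} [IsMarkovKernel p]
    (hP : ∀ᵐ h ∂(law μ Q P i), P.kernel i h = p (s h.1)) :
    stageInfo μ Q P i =
      expLogRatio (statLaw μ Q P i s) q ((p ⊗ₖ q).snd.comap Prod.fst measurable_fst) := by
  rw [← expLogRatio_comap_stat μ Q P i hs hq, stageInfo, expLogRatio, expLogRatio]
  congr 1
  refine Measure.compProd_congr ?_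
  have h := outKernel_ae_eq μ Q P i hs hq hP
  rw [← map_inputLaw_outPast] at h
  exact ae_of_ae_map (f := fun x : Hist A B i × A i => x.1.1) (by fun_prop) h

/-- No restriction on `P` is needed, because `Π_i^P` is always the conditional output law; the
history is only regrouped as `B^{i-1}` and `A^i`. -/
theorem stageInfo_eq_condMutualInfo [∀ i, StandardBorelSpace (B i)] [∀ i, Nonempty (B i)] :
    stageInfo μ Q P i = condMutualInfo (pastLaw μ Q P i) := by
  have : IsProbabilityMeasure ((inputLaw μ Q P i).map MeasurableEquiv.prodAssoc) :=
    Measure.isProbabilityMeasure_map (by fun_prop)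
  have h : (fullLaw μ Q P i).map (fun x => (MeasurableEquiv.prodAssoc x.1, x.2)) =
      (inputLaw μ Q P i).map MeasurableEquiv.prodAssoc ⊗ₘ Q.onPast i :=
    map_prodMap_compProd_comap (inputLaw μ Q P i) (Q.onPast i)
      (MeasurableEquiv.measurable MeasurableEquiv.prodAssoc)
  rw [← expLogRatio_eq_condMutualInfo ((inputLaw μ Q P i).map MeasurableEquiv.prodAssoc)
    (Q.onPast i) (outKernel μ Q P i) ?_ (pastLaw μ Q P i) ?_]
  · exact expLogRatio_comap (inputLaw μ Q P i) (Q.onPast i)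
      ((outKernel μ Q P i).comap Prod.fst measurable_fst)
      (MeasurableEquiv.measurable MeasurableEquiv.prodAssoc)
  · have h1 : ((inputLaw μ Q P i).map MeasurableEquiv.prodAssoc).fst = (law μ Q P i).fst := by
      rw [← map_inputLaw_outPast, Measure.fst, Measure.map_map (by fun_prop) (by fun_prop)]
      rfl
    rw [h1, compProd_outKernel, ← h, Measure.map_map (by fun_prop) (by fun_prop)]
    rfl
  · rw [← h, Measure.map_map (by fun_prop) (by fun_prop)]
    rfl

theorem expLogRatio_statLaw_eq_condMutualInfo [∀ i, StandardBorelSpace (B i)]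
    [∀ i, Nonempty (B i)] (hs : Measurable s) {q : Kernel (S × A i) (B i)} [IsMarkovKernel q]
    (hq : Q.onHist i = q.comap (fun x : Hist A B i × A i => (s x.1.1, x.2)) (by fun_prop))
    {p : Kernel S (A i)} [IsMarkovKernel p]
    (hP : statLaw μ Q P i s = (law μ Q P i).fst.map s ⊗ₘ p)
    (τ : Measure (S × (A i × B i))) [IsFiniteMeasure τ]
    (hτ : τ = (fullLaw μ Q P i).map fun x => (s x.1.1.1, (x.1.2, x.2))) :
    expLogRatio (statLaw μ Q P i s) q ((p ⊗ₖ q).snd.comap Prod.fst measurable_fst) =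
      condMutualInfo τ := by
  have := isProbabilityMeasure_statLaw μ Q P i hs
  have : IsProbabilityMeasure ((law μ Q P i).fst.map s) :=
    Measure.isProbabilityMeasure_map hs.aemeasurable
  refine expLogRatio_eq_condMutualInfo _ _ _ ?_ _ ?_
  · rw [hP, Measure.fst_compProd, map_fst_snd_compProd_compProd]
  · rw [← map_fullLaw_eq_compProd μ Q P i hs hq, Measure.map_map (by fun_prop) (by fun_prop), hτ]
    rfl

end Stage

section Family

/-! ### Preservation of laws along recursive statistics of the past outputs -/

/-- The law of `s_{i+1}` is computed from that of `s_i` by `p_i`, `q_i` and the update `g_i`, which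
the two inputs share; at time `0` both laws come from `μ`. Joint laws with past inputs may well
differ. -/
theorem map_stat_law_eq (μ : Measure (OutPast B 0)) [IsProbabilityMeasure μ] (Q : Channel A B M)
    (P P' : Input A B) {S : ℕ → Type*} [∀ i, MeasurableSpace (S i)]
    {s : ∀ i, OutPast B i → S i} (hs : ∀ i, Measurable (s i))
    {q : ∀ i, Kernel (S i × A i) (B i)} [∀ i, IsMarkovKernel (q i)]
    (hq : ∀ i, Q.onHist i =
      (q i).comap (fun x : Hist A B i × A i => (s i x.1.1, x.2)) (by fun_prop))
    {g : ∀ i, S i × B i → S (i + 1)} (hg : ∀ i, Measurable (g i))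
    (hsg : ∀ i (b : OutPast B i) (y : B i),
      s (i + 1) (snoc (X := B) (fun j hj => by push_cast at hj; omega) b y) = g i (s i b, y))
    {p : ∀ i, Kernel (S i) (A i)}
    (hP : ∀ i, statLaw μ Q P i (s i) = (law μ Q P i).fst.map (s i) ⊗ₘ p i)
    (hP' : ∀ i, statLaw μ Q P' i (s i) = (law μ Q P' i).fst.map (s i) ⊗ₘ p i) (i : ℕ) :
    (law μ Q P i).fst.map (s i) = (law μ Q P' i).fst.map (s i) := by
  have step : ∀ (P : Input A B) (i : ℕ), (law μ Q P (i + 1)).fst.map (s (i + 1)) =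
      (statLaw μ Q P i (s i) ⊗ₘ q i).map fun z => g i (z.1.1, z.2) := by
    intro P i
    have hm : Measurable fun x : (Hist A B i × A i) × B i =>
        (snoc (X := B) (k := ((i + 1 : ℕ) : ℤ)) (fun j hj => by push_cast at hj; omega)
            x.1.1.1 x.2,
          snoc (X := A) (k := i + 1) (fun j hj => by omega) x.1.1.2 x.1.2) :=
      Measurable.prodMk
        ((measurable_snoc (X := B) (i := (i : ℤ)) (k := ((i + 1 : ℕ) : ℤ))
          (fun j hj => by push_cast at hj; omega)).comp
          ((measurable_fst.comp (measurable_fst.comp measurable_fst)).prodMk measurable_snd))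
        ((measurable_snoc (X := A) (i := i) (k := i + 1) (fun j hj => by omega)).comp
          ((measurable_snd.comp (measurable_fst.comp measurable_fst)).prodMk
            (measurable_snd.comp measurable_fst)))
    have hl : law μ Q P (i + 1) = (fullLaw μ Q P i).map _ := rfl
    rw [← map_fullLaw_eq_compProd μ Q P i (hs i) (hq i),
      Measure.map_map (by have := hg i; fun_prop) (by have := hs i; fun_prop), hl, Measure.fst,
      Measure.map_map measurable_fst hm, Measure.map_map (hs _) (measurable_fst.comp hm)]
    congr 1
    funext x
    exact hsg i _ _
  induction i with
  | zero => rfl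
  | succ i ih => rw [step, step, hP, hP', ih]

end Family

end Model

/-! ### Maximization by pointwise domination; windows as recursive statistics -/

theorem maximizationOccursIn_of_forall_exists_le {α : Type*} {F : α → ℝ≥0∞} {S T : Set α}
    (hTS : T ⊆ S) (h : ∀ P ∈ S, ∃ P' ∈ T, F P ≤ F P') : MaximizationOccursIn F S T := by
  refine ⟨hTS, le_antisymm (iSup₂_le fun P hP => ?_) (biSup_mono fun _ hP => hTS hP), ?_⟩
  · obtain ⟨P', hP', hle⟩ := h P hP
    exact hle.trans (le_iSup₂ (f := fun P (_ : P ∈ T) => F P) P' hP')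
  · rintro ⟨P, hP, hmax⟩
    obtain ⟨P', hP', hle⟩ := h P hP
    exact ⟨P', hP', fun R hR => (hmax hR).trans hle⟩

/-- `(b_{i-J}^{i-1}, b_i) ↦ b_{i+1-J}^{i}`. -/
def windowStep (B : ℤ → Type*) (J i : ℕ) (x : Window B J i × B i) : Window B J (i + 1) :=
  fun j => if hj : (j : ℤ) < i then x.1 ⟨j, by have := j.2.1; push_cast at this; omega, hj⟩
    else (le_antisymm (not_lt.1 hj) (by have := j.2.2; push_cast at this; omega) :
      (i : ℤ) = (j : ℤ)) ▸ x.2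

/-- This is the recursion that `map_stat_law_eq` asks of a statistic: the new window needs no output
older than the current window. -/
theorem window_snoc {B : ℤ → Type*} (J i : ℕ) (b : OutPast B i) (y : B i) :
    window J (i + 1) (snoc (X := B) (fun j hj => by push_cast at hj; omega) b y) =
      windowStep B J i (window J i b, y) := rfl

section Model

variable {A : ℕ → Type*} {B : ℤ → Type*} [∀ i, MeasurableSpace (A i)]
  [∀ i, MeasurableSpace (B i)] {M : ℕ}

/-- The expected cost is an integral against the laws of `(s_i, A_i)`, so the replacement input
meets the same constraint. -/
theorem avgCost_congr (μ : Measure (OutPast B 0)) [IsProbabilityMeasure μ]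
    (Q : Channel A B M) (n : ℕ) {S : ℕ → Type*} [∀ i, MeasurableSpace (S i)]
    {s : ∀ i, OutPast B i → S i} (hs : ∀ i, Measurable (s i))
    {γ : ∀ i, A i × S i → ℝ≥0} (hγ : ∀ i, Measurable (γ i)) {P P' : Input A B}
    (h : ∀ i, statLaw μ Q P i (s i) = statLaw μ Q P' i (s i)) :
    avgCost μ Q n (fun i x => γ i (x.1, s i x.2)) P =
      avgCost μ Q n (fun i x => γ i (x.1, s i x.2)) P' := by
  have key : ∀ (P : Input A B) i, ∫⁻ x, γ i (x.2, s i x.1.1) ∂(inputLaw μ Q P i) =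
      ∫⁻ z, γ i (z.2, z.1) ∂(statLaw μ Q P i (s i)) := fun P i => by
    rw [statLaw, lintegral_map (by fun_prop) (by fun_prop)]
  simp only [avgCost, key, h]

theorem measurable_windowStep (J i : ℕ) : Measurable (windowStep B J i) := by
  refine measurable_pi_lambda _ fun j => ?_
  by_cases hj : (j : ℤ) < i
  · simp only [windowStep, hj, dite_true]
    exact (measurable_pi_apply _).comp measurable_fst
  · simp only [windowStep, hj, dite_false]
    exact (measurable_cast_symbol _).comp measurable_snd

/-! ### Domination and maximization -/

variable [∀ i, StandardBorelSpace (A i)] [∀ i, Nonempty (A i)]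

/-- Kernels given the statistics `s i` of the past outputs, as an input distribution. -/
noncomputable def statInput {S : ℕ → Type*} [∀ i, MeasurableSpace (S i)]
    {s : ∀ i, OutPast B i → S i} (hs : ∀ i, Measurable (s i)) (p : KernelSeq S A) :
    Input A B where
  kernel i := (p.kernel i).comap (fun h : Hist A B i => s i h.1) ((hs i).comp measurable_fst)
  markov _ := inferInstance

/-- Every input distribution is dominated by one that depends only on a recursive statistic of the
past outputs sufficient for the channel, with the same joint laws of this statistic and of the
channel input. -/
theorem exists_statInput_ge [∀ i, StandardBorelSpace (B i)] [∀ i, Nonempty (B i)]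
    (μ : Measure (OutPast B 0)) [IsProbabilityMeasure μ]
    (Q : Channel A B M) (P : Input A B) {S : ℕ → Type*} [∀ i, MeasurableSpace (S i)]
    {s : ∀ i, OutPast B i → S i} (hs : ∀ i, Measurable (s i))
    {q : ∀ i, Kernel (S i × A i) (B i)} [∀ i, IsMarkovKernel (q i)]
    (hq : ∀ i, Q.onHist i =
      (q i).comap (fun x : Hist A B i × A i => (s i x.1.1, x.2)) (by fun_prop))
    {g : ∀ i, S i × B i → S (i + 1)} (hg : ∀ i, Measurable (g i))
    (hsg : ∀ i (b : OutPast B i) (y : B i),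
      s (i + 1) (snoc (X := B) (fun j hj => by push_cast at hj; omega) b y) = g i (s i b, y)) :
    ∃ p : KernelSeq S A, ∀ i,
      statLaw μ Q (statInput hs p) i (s i) = statLaw μ Q P i (s i) ∧
      stageInfo μ Q P i ≤ stageInfo μ Q (statInput hs p) i := by
  choose p hp hP using fun i => exists_statLaw_eq_compProd μ Q P i (hs i)
  let π : KernelSeq S A := ⟨p, hp⟩
  have hπ : ∀ i, ∀ᵐ h ∂(law μ Q (statInput hs π) i),
      (statInput hs π).kernel i h = p i (s i h.1) := fun i => ae_of_all _ fun _ => rfl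
  have hP' := fun i => statLaw_eq_compProd μ Q (statInput hs π) i (hs i) (hπ i)
  have hlaw : ∀ i, statLaw μ Q (statInput hs π) i (s i) = statLaw μ Q P i (s i) := fun i => by
    rw [hP, hP', map_stat_law_eq μ Q P (statInput hs π) hs hq hg hsg hP hP' i]
  refine ⟨π, fun i => ⟨hlaw i, ?_⟩⟩
  -- Once the laws of `(s_i, A_i)` are identified, the term of the new input is the upper bound of
  -- `stageInfo_le` for `P`, with the output kernel induced by `p i` as reference.
  rw [stageInfo_eq μ Q (statInput hs π) i (hs i) (hq i) (hπ i), hlaw]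
  exact stageInfo_le μ Q P i (hs i) (hq i) _

variable [∀ i, StandardBorelSpace (B i)] [∀ i, Nonempty (B i)]

theorem exists_windowInput_ge (μ : Measure (OutPast B 0)) [IsProbabilityMeasure μ]
    (Q : Channel A B M) {J : ℕ} (hJ : M ≤ J) (P : Input A B) :
    ∃ p : WindowInput A B J, ∀ i,
      statLaw μ Q p.toInput i (window J i) = statLaw μ Q P i (window J i) ∧
      stageInfo μ Q P i ≤ stageInfo μ Q p.toInput i :=
  exists_statInput_ge μ Q P (measurable_window J) (q := Q.onWindow hJ) (fun _ => rfl)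
    (measurable_windowStep J) (window_snoc J)

theorem windowPayoff_eq_directedInfo (μ : Measure (OutPast B 0)) [IsProbabilityMeasure μ]
    (Q : Channel A B M) {J : ℕ} (hJ : M ≤ J) (n : ℕ) (p : WindowInput A B J) :
    windowPayoff μ Q hJ n p = directedInfo μ Q n p.toInput :=
  Finset.sum_congr rfl fun i _ =>
    (stageInfo_eq μ Q p.toInput i (measurable_window J i) (q := Q.onWindow hJ i) rfl
      (ae_of_all _ fun _ => rfl)).symm

theorem windowInfo_eq_directedInfo (μ : Measure (OutPast B 0)) [IsProbabilityMeasure μ]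
    (Q : Channel A B M) {J : ℕ} (hJ : M ≤ J) (n : ℕ) (p : WindowInput A B J) :
    windowInfo μ Q n p = directedInfo μ Q n p.toInput := by
  refine Finset.sum_congr rfl fun i _ => ?_
  have hp : ∀ᵐ h ∂(law μ Q p.toInput i), p.toInput.kernel i h = p.kernel i (window J i h.1) :=
    ae_of_all _ fun _ => rfl
  have hw := measurable_window (B := B) J i
  exact ((stageInfo_eq μ Q p.toInput i hw (q := Q.onWindow hJ i) rfl hp).trans
    (expLogRatio_statLaw_eq_condMutualInfo μ Q p.toInput i hw rfl
      (statLaw_eq_compProd μ Q p.toInput i hw hp) _ rfl)).symm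

/-- Maximization over a set of input distributions that is stable under changes which preserve
the joint laws of `(B_{i-J}^{i-1}, A_i)`. -/
theorem maximization_window (μ : Measure (OutPast B 0)) [IsProbabilityMeasure μ]
    (Q : Channel A B M) {J : ℕ} (hJ : M ≤ J) (n : ℕ) {C : Set (Input A B)}
    (hC : ∀ P ∈ C, ∀ P' : Input A B,
      (∀ i, statLaw μ Q P' i (window J i) = statLaw μ Q P i (window J i)) → P' ∈ C) :
    MaximizationOccursIn (directedInfo μ Q n) C (windowClass μ Q n J ∩ C) ∧
      (⨆ P ∈ C, directedInfo μ Q n P) =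
        ⨆ p : {p : WindowInput A B J // p.toInput ∈ C}, windowPayoff μ Q hJ n p.1 ∧
      (⨆ P ∈ C, directedInfo μ Q n P) =
        ⨆ p : {p : WindowInput A B J // p.toInput ∈ C}, windowInfo μ Q n p.1 := by
  have key : ∀ P ∈ C, ∃ p : WindowInput A B J, p.toInput ∈ C ∧
      directedInfo μ Q n P ≤ directedInfo μ Q n p.toInput := fun P hP => by
    obtain ⟨p, hp⟩ := exists_windowInput_ge μ Q hJ P
    exact ⟨p, hC P hP _ fun i => (hp i).1, Finset.sum_le_sum fun i _ => (hp i).2⟩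
  have hsup : (⨆ P ∈ C, directedInfo μ Q n P) =
      ⨆ p : {p : WindowInput A B J // p.toInput ∈ C}, directedInfo μ Q n p.1.toInput := by
    refine le_antisymm (iSup₂_le fun P hP => ?_) (iSup_le fun p => ?_)
    · obtain ⟨p, hpC, hle⟩ := key P hP
      exact hle.trans (le_iSup
        (fun p : {p : WindowInput A B J // p.toInput ∈ C} => directedInfo μ Q n p.1.toInput)
        ⟨p, hpC⟩)
    · exact le_iSup₂ (f := fun P (_ : P ∈ C) => directedInfo μ Q n P) p.1.toInput p.2
  refine ⟨maximizationOccursIn_of_forall_exists_le Set.inter_subset_right fun P hP => ?_, ?_, ?_⟩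
  · obtain ⟨p, hpC, hle⟩ := key P hP
    exact ⟨p.toInput, ⟨⟨p, fun i _ => ae_of_all _ fun _ => rfl⟩, hpC⟩, hle⟩
  · simp only [hsup, windowPayoff_eq_directedInfo]
  · simp only [hsup, windowInfo_eq_directedInfo μ Q hJ]

/-- The statistic is the whole output past, so the replacement only removes the dependence on past
inputs, and a cost in `(a_i, b^{i-1})` is preserved. -/
theorem maximization_output (μ : Measure (OutPast B 0)) [IsProbabilityMeasure μ]
    (Q : Channel A B M) (n : ℕ) {γ : ∀ i, A i × OutPast B i → ℝ≥0} (hγ : ∀ i, Measurable (γ i))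
    (κ : ℝ≥0) :
    MaximizationOccursIn (directedInfo μ Q n) (costClass μ Q n γ κ)
      (outputClass μ Q n ∩ costClass μ Q n γ κ) := by
  refine maximizationOccursIn_of_forall_exists_le Set.inter_subset_right fun P hP => ?_
  obtain ⟨p, hp⟩ := exists_statInput_ge μ Q P (S := OutPast B) (s := fun _ => id)
    (fun _ => measurable_id)
    (q := fun i => (Q.kernel i).comap (fun x : OutPast B i × A i => (window M i x.1, x.2))
      (by have := measurable_window (B := B) M i; fun_prop)) (fun _ => rfl)
    (g := fun i x => snoc (X := B) (fun j hj => by push_cast at hj; omega) x.1 x.2)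
    (fun i => measurable_snoc (X := B) (i := (i : ℤ)) (k := ((i + 1 : ℕ) : ℤ))
      (fun j hj => by push_cast at hj; omega)) (fun _ _ _ => rfl)
  refine ⟨statInput (fun _ => measurable_id) p, ⟨⟨p, fun i _ => ae_of_all _ fun _ => rfl⟩, ?_⟩,
    Finset.sum_le_sum fun i _ => (hp i).2⟩
  exact (avgCost_congr μ Q n (fun _ => measurable_id) hγ fun i => (hp i).1).trans_le hP

end Model

end FTFI

/-! ### Assembly of the theorem -/

open FTFI in
theorem mainTheorem1 {A : ℕ → Type*} {B : ℤ → Type*}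
    [∀ i, MeasurableSpace (A i)] [∀ i, StandardBorelSpace (A i)] [∀ i, Nonempty (A i)]
    [∀ i, MeasurableSpace (B i)] [∀ i, StandardBorelSpace (B i)] [∀ i, Nonempty (B i)]
    (M : ℕ) (Q : Channel A B M) (μ : Measure (OutPast B 0)) [IsProbabilityMeasure μ] (n : ℕ) :
    -- Directed information in terms of conditional mutual information
    (∀ P : Input A B, directedInfo μ Q n P =
      ∑ i ∈ Finset.range (n + 1), condMutualInfo (pastLaw μ Q P i)) ∧
    -- Output process and joint distributions for memory-`J` inputs, `J ≥ M`
    (∀ (J : ℕ) (hJ : M ≤ J) (P : Input A B) (p : WindowInput A B J), EqWindow μ Q n P p →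
      ∀ i ≤ n,
        (∀ᵐ b ∂(law μ Q P i).fst,
          outKernel μ Q P i b = windowOutKernel Q hJ p i (window J i b)) ∧
        windowLaw μ Q P J i =
          ((law μ Q P i).fst.map (window J i)) ⊗ₘ (p.kernel i ⊗ₖ Q.onWindow hJ i)) ∧
    -- Part A
    (MaximizationOccursIn (directedInfo μ Q n) Set.univ (windowClass μ Q n M) ∧
      (⨆ P : Input A B, directedInfo μ Q n P) =
        ⨆ p : WindowInput A B M, windowPayoff μ Q le_rfl n p ∧
      (⨆ P : Input A B, directedInfo μ Q n P) =
        ⨆ p : WindowInput A B M, windowInfo μ Q n p) ∧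
    -- Part B
    (∀ (K : ℕ) (γ : ∀ i, A i × Window B K i → ℝ≥0), (∀ i, Measurable (γ i)) → ∀ κ : ℝ≥0,
      MaximizationOccursIn (directedInfo μ Q n) (costClass μ Q n (windowCost γ) κ)
        (windowClass μ Q n (max M K) ∩ costClass μ Q n (windowCost γ) κ) ∧
      (⨆ P ∈ costClass μ Q n (windowCost γ) κ, directedInfo μ Q n P) =
        ⨆ p : {p : WindowInput A B (max M K) //
            p.toInput ∈ costClass μ Q n (windowCost γ) κ},
          windowPayoff μ Q (le_max_left M K) n p.1 ∧
      (⨆ P ∈ costClass μ Q n (windowCost γ) κ, directedInfo μ Q n P) =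
        ⨆ p : {p : WindowInput A B (max M K) //
            p.toInput ∈ costClass μ Q n (windowCost γ) κ},
          windowInfo μ Q n p.1) ∧
    -- Part C
    (∀ (γ : ∀ i, A i × OutPast B i → ℝ≥0), (∀ i, Measurable (γ i)) → ∀ κ : ℝ≥0,
      MaximizationOccursIn (directedInfo μ Q n) (costClass μ Q n γ κ)
        (outputClass μ Q n ∩ costClass μ Q n γ κ)) := by
  refine ⟨fun P => Finset.sum_congr rfl fun i _ => stageInfo_eq_condMutualInfo μ Q P i, ?_, ?_,
    ?_, fun γ hγ κ => maximization_output μ Q n hγ κ⟩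
  · intro J hJ P p hP i hi
    have hw := measurable_window (B := B) J i
    refine ⟨outKernel_ae_eq μ Q P i hw (q := Q.onWindow hJ i) rfl (hP i hi), ?_⟩
    have : IsProbabilityMeasure ((law μ Q P i).fst.map (window J i)) :=
      Measure.isProbabilityMeasure_map hw.aemeasurable
    rw [← Measure.compProd_assoc', ← statLaw_eq_compProd μ Q P i hw (hP i hi),
      ← map_fullLaw_eq_compProd μ Q P i hw (q := Q.onWindow hJ i) rfl,
      Measure.map_map (by fun_prop) (by fun_prop)]
    rfl
  -- Without a constraint, the stability condition on `C` is vacuous and the shortest window `J = M`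
  -- suffices.
  · obtain ⟨h1, h2, h3⟩ := maximization_window μ Q le_rfl n (C := Set.univ)
      fun _ _ _ _ => Set.mem_univ _
    have e : ∀ F : WindowInput A B M → ℝ≥0∞,
        (⨆ p : {p : WindowInput A B M // p.toInput ∈ (Set.univ : Set (Input A B))}, F p.1) =
          ⨆ p, F p := fun F => by
      rw [iSup_subtype]; simp
    simp only [e, Set.mem_univ, iSup_pos, Set.inter_univ] at h1 h2 h3
    exact ⟨h1, h2, h3⟩
  · intro K γ hγ κ
    refine maximization_window μ Q (le_max_left M K) n fun P hP P' h => ?_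
    -- The cost reads only the last `K` outputs, so it factors through the window of length `max M
    -- K`, whose joint law with the input is preserved.
    refine (avgCost_congr μ Q n (measurable_window (max M K))
      (γ := fun i x => γ i (x.1, shorten (le_max_right M K) i x.2)) (fun i => ?_) h).trans_le hP
    have := measurable_shorten (B := B) (le_max_right M K) i
    have := hγ i
    fun_prop
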